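/- Let $P=\{p_1,\dots,p_n\}$ be $n$ distinct points at unknown positions $x_1,\dots,x_n$ on the real line. A distance query on a pair $\{p_i,p_j\}$ returns $|x_i-x_j|$. A point placement graph (ppg) on $P$ is a graph with vertex set $P$ whose edges carry lengths; a placement of it is an assignment of pairwise distinct real positions to the points such that every edge $p_ip_j$ has length $|x_i-x_j|$, and the ppg is line rigid if it has a placement and this placement is unique up to translation and reflection. A deterministic two-round algorithm for $n$ points queries in the first round a fixed set $E_1$ of pairs, and in the second round a set $E_2$ of pairs that is a function of the lengths returned in the first round; it produces the ppg $(P,E_1\cup E_2)$ with the returned lengths. The minimum density (asymptotic number of edges per point) of a line rigid ppg for two-round algorithms is at least $9/8$: for every $\varepsilon>0$ there is an $N$ such that for all $n\ge N$ and every deterministic two-round algorithm for $n$ points that produces a line rigid ppg for all positions of $n$ distinct points on the line, there are distinct positions $x_1,\dots,x_n$ for which the produced ppg has $|E_1\cup E_2|\ge\left(\tfrac98-\varepsilon\right)n$ edges. -/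

import Mathlib

/-- The distance between the two end points of a pair, for points `x i` on the real line. -/
def pairDist {n : ℕ} (x : Fin n → ℝ) : Sym2 (Fin n) → ℝ :=
  Sym2.lift ⟨fun i j => |x i - x j|, fun i j => abs_sub_comm (x i) (x j)⟩

/-- A point placement graph on the points `p_0, …, p_{n-1}`: the queried pairs, together with the
length returned for each of them. -/
structure PointPlacementGraph (n : ℕ) where
  graph : SimpleGraph (Fin n)
  length : graph.edgeSet → ℝ

/-- A placement of a ppg: pairwise distinct points on the line realising all the edge lengths. -/
def PointPlacementGraph.IsPlacement {n : ℕ} (G : PointPlacementGraph n) (x : Fin n → ℝ) : Prop :=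
  Function.Injective x ∧ ∀ e : G.graph.edgeSet, pairDist x e = G.length e

/-- Two placements are the same up to translation and reflection of the line. -/
def SamePlacement {n : ℕ} (x y : Fin n → ℝ) : Prop :=
  (∃ t : ℝ, ∀ i, y i = t + x i) ∨ (∃ t : ℝ, ∀ i, y i = t - x i)

/-- A ppg is line rigid when it has a placement, unique up to translation and reflection. -/
def PointPlacementGraph.IsLineRigid {n : ℕ} (G : PointPlacementGraph n) : Prop :=
  (∃ x, G.IsPlacement x) ∧ ∀ x y, G.IsPlacement x → G.IsPlacement y → SamePlacement x y

/-- A deterministic two-round query algorithm for `n` points: the edges `E₁` queried in the first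
round are fixed, and the edges `E₂` queried in the second round are a function of the lengths
returned in the first round. -/
structure TwoRoundAlgorithm (n : ℕ) where
  firstRound : SimpleGraph (Fin n)
  secondRound : (firstRound.edgeSet → ℝ) → SimpleGraph (Fin n)

namespace TwoRoundAlgorithm

variable {n : ℕ} (A : TwoRoundAlgorithm n)

/-- The lengths returned in the first round when the points are at the positions `x`. -/
def firstAnswers (x : Fin n → ℝ) : A.firstRound.edgeSet → ℝ :=
  fun e => pairDist x e

/-- The ppg `(V, E₁ ∪ E₂)` known after both rounds when the points are at the positions `x`. -/
def ppg (x : Fin n → ℝ) : PointPlacementGraph n where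
  graph := A.firstRound ⊔ A.secondRound (A.firstAnswers x)
  length := fun e => pairDist x e

/-- The number of edges of the ppg, i.e. of pairs queried over the two rounds. -/
noncomputable def numQueries (x : Fin n → ℝ) : ℕ :=
  (A.ppg x).graph.edgeSet.ncard

/-- The algorithm solves the point placement problem: whatever the positions of the `n` distinct
points are, the ppg it produces is line rigid. -/
def ProducesLineRigid : Prop :=
  ∀ x : Fin n → ℝ, Function.Injective x → (A.ppg x).IsLineRigid

end TwoRoundAlgorithm

/-! The bound comes from an adversary argument. Let `G` be the first-round graph and `F ⊇ G` the
final one. `F` depends only on the lengths on `G`, so it must be rigid for every placement with the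
same `G`-lengths (`RigidOver`). The adversary takes a matching of `G` and a colouring that is
constant along the other edges of `G`. It puts each point at a small offset plus its colour read as
0 or 1. The two ends of a matching edge with different colours (a cut pair) share their offset, so
they lie at distance exactly 1, while every other edge of `G` joins points of equal level. Points
isolated in `G` do not affect the answers, so they can be moved after `F` is known, and the cut
pairs can be extended by edges of `F` at such points (`exists_mateExtension`).

Rigidity then forces two things. Deleting all pair edges leaves `F` connected
(`deleteMatching_preconnected`), which makes `F` have about one edge per point plus one per pair.
Every unpaired point has degree at least 2 in `F` (`exists_adj_ne`).

This is strong when there are many pairs. The other cases are covered by the choice of matching and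
colouring. Edges at unmatched points are extra edges of `G` (`sum_degree_le`). Uncut matching edges
can be deleted without splitting a component, so they are extra too (`exists_cut_colouring`,
`card_add_uncut_le`). Isolated points, unmatched leaves and components without cut pairs force edges
of `F \ G` (`two_mul_card_sdiff_ge`). A linear combination of these counts gives `9 |V| ≤ 8 |F| + 7`
(`nine_mul_card_le`). -/

namespace SimpleGraph

/-! ### Components and edge counts. -/

section ComponentCount

variable {V : Type*}

theorem reachable_sup_edge_cases {H : SimpleGraph V} {u v a b : V}
    (h : (H ⊔ edge u v).Reachable a b) :
    H.Reachable a b ∨ (H.Reachable a u ∧ H.Reachable v b) ∨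
      (H.Reachable a v ∧ H.Reachable u b) := by
  obtain ⟨p⟩ := h
  induction p with
  | nil => exact Or.inl (Reachable.refl _)
  | @cons a c b hadj p ih =>
    rw [sup_adj, edge_adj] at hadj
    rcases hadj with hadj | ⟨⟨rfl, rfl⟩ | ⟨rfl, rfl⟩, -⟩
    · rcases ih with ih | ⟨h1, h2⟩ | ⟨h1, h2⟩
      · exact Or.inl (hadj.reachable.trans ih)
      · exact Or.inr (Or.inl ⟨hadj.reachable.trans h1, h2⟩)
      · exact Or.inr (Or.inr ⟨hadj.reachable.trans h1, h2⟩)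
    · rcases ih with ih | ⟨h1, h2⟩ | ⟨h1, h2⟩
      · exact Or.inr (Or.inl ⟨Reachable.refl _, ih⟩)
      · exact Or.inr (Or.inl ⟨Reachable.refl _, h2⟩)
      · exact Or.inl h2
    · rcases ih with ih | ⟨h1, h2⟩ | ⟨h1, h2⟩
      · exact Or.inr (Or.inr ⟨Reachable.refl _, ih⟩)
      · exact Or.inl h2
      · exact Or.inr (Or.inr ⟨Reachable.refl _, h2⟩)

variable [Finite V]

/-- The new edge can merge only the components of `u` and `v`. With the component of `v` sent to
`none`, the map to the components of the larger graph is injective. -/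
theorem card_connectedComponent_le_sup_edge (H : SimpleGraph V) (u v : V) :
    Nat.card H.ConnectedComponent ≤ Nat.card (H ⊔ edge u v).ConnectedComponent + 1 := by
  classical
  let g : H.ConnectedComponent → Option (H ⊔ edge u v).ConnectedComponent := fun c =>
    if c = H.connectedComponentMk v then none
    else some (c.map (Hom.ofLE le_sup_left))
  have hg : Function.Injective g := by
    intro c d hcd
    simp only [g] at hcd
    split_ifs at hcd with h1 h2 h2
    · rw [h1, h2]
    · induction c using ConnectedComponent.ind with | _ c =>
      induction d using ConnectedComponent.ind with | _ d =>
      rw [Option.some_inj, ConnectedComponent.map_mk, ConnectedComponent.map_mk,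
        ConnectedComponent.eq] at hcd
      rw [ConnectedComponent.eq] at *
      rcases reachable_sup_edge_cases hcd with h | ⟨-, h⟩ | ⟨h, -⟩
      · exact h
      · exact absurd h.symm h2
      · exact absurd h h1
  calc Nat.card H.ConnectedComponent
      ≤ Nat.card (Option (H ⊔ edge u v).ConnectedComponent) := Nat.card_le_card_of_injective g hg
    _ = _ := by rw [Finite.card_option]

theorem card_connectedComponent_le_add_ncard {H F : SimpleGraph V} (hHF : H ≤ F) :
    Nat.card H.ConnectedComponent ≤
      Nat.card F.ConnectedComponent + (F.edgeSet \ H.edgeSet).ncard := by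
  induction hk : (F.edgeSet \ H.edgeSet).ncard generalizing H with
  | zero =>
    rw [Set.ncard_eq_zero, Set.sdiff_eq_empty, edgeSet_subset_edgeSet] at hk
    rw [le_antisymm hHF hk, add_zero]
  | succ k ih =>
    have hne : (F.edgeSet \ H.edgeSet).Nonempty := by
      rw [← Set.ncard_pos]; omega
    obtain ⟨e, he⟩ := hne
    induction e with | _ u v =>
    have hF : F.Adj u v := he.1
    have hle : H ⊔ edge u v ≤ F := sup_le hHF (by
      rw [edge_le_iff]; exact Or.inr hF)
    have hset : F.edgeSet \ (H ⊔ edge u v).edgeSet = (F.edgeSet \ H.edgeSet) \ {s(u, v)} := by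
      rw [edgeSet_sup, edgeSet_edge_of_ne hF.ne]
      ext e
      simp only [Set.mem_sdiff, Set.mem_union, Set.mem_singleton_iff]
      tauto
    have hcard : (F.edgeSet \ (H ⊔ edge u v).edgeSet).ncard = k := by
      rw [hset, Set.ncard_sdiff_singleton_of_mem he, hk, Nat.add_sub_cancel]
    have h1 := ih hle hcard
    have h2 := card_connectedComponent_le_sup_edge H u v
    omega

theorem card_le_card_connectedComponent_add_ncard (F : SimpleGraph V) :
    Nat.card V ≤ Nat.card F.ConnectedComponent + F.edgeSet.ncard := by
  have h := card_connectedComponent_le_add_ncard (bot_le (a := F))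
  rw [edgeSet_bot, Set.sdiff_empty] at h
  refine le_trans ?_ h
  refine Nat.card_le_card_of_injective (connectedComponentMk ⊥) fun a b hab => ?_
  rw [ConnectedComponent.eq] at hab
  simpa using hab

theorem card_connectedComponent_le_of_reachable {H G : SimpleGraph V}
    (h : ∀ u v, G.Adj u v → H.Reachable u v) :
    Nat.card H.ConnectedComponent ≤ Nat.card G.ConnectedComponent := by
  have key : ∀ u v, G.Reachable u v → H.Reachable u v := by
    rintro u v ⟨p⟩
    induction p with
    | nil => exact Reachable.refl _
    | cons hadj _ ih => exact (h _ _ hadj).trans ih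
  let g : G.ConnectedComponent → H.ConnectedComponent :=
    ConnectedComponent.lift H.connectedComponentMk fun u v p _ =>
      ConnectedComponent.sound (key u v ⟨p⟩)
  refine Nat.card_le_card_of_surjective g fun c => ?_
  induction c using ConnectedComponent.ind with | _ c =>
  exact ⟨G.connectedComponentMk c, rfl⟩

end ComponentCount

end SimpleGraph

/-! ### Matchings as involutions, and maximum-weight matchings. -/

section Involution

open scoped Classical

variable {V : Type*}

theorem Function.Involutive.two_mul_ncard_pairs [Fintype V] {m : V → V} (hm : Function.Involutive m)
    {P : V → Prop} [DecidablePred P] (hP : ∀ v, P v → P (m v) ∧ m v ≠ v) :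
    2 * {e : Sym2 V | ∃ v, P v ∧ e = s(v, m v)}.ncard = (Finset.univ.filter P).card := by
  have himg : {e : Sym2 V | ∃ v, P v ∧ e = s(v, m v)} =
      ((Finset.univ.filter P).image fun v => s(v, m v) : Finset (Sym2 V)) := by
    ext e
    simp [eq_comm]
  rw [himg, Set.ncard_coe_finset]
  rw [Finset.card_eq_sum_card_image (fun v => s(v, m v)) (Finset.univ.filter P), mul_comm,
    ← smul_eq_mul, ← Finset.sum_const]
  refine Finset.sum_congr rfl fun e he => ?_
  obtain ⟨a, ha, rfl⟩ := Finset.mem_image.1 he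
  rw [Finset.mem_filter] at ha
  have hfib : (Finset.univ.filter P).filter (fun v => s(v, m v) = s(a, m a)) = {a, m a} := by
    ext v
    simp only [Finset.mem_filter, Finset.mem_univ, true_and, Sym2.eq_iff, Finset.mem_insert,
      Finset.mem_singleton]
    constructor
    · rintro ⟨-, ⟨h, -⟩ | ⟨h, -⟩⟩
      · exact Or.inl h
      · exact Or.inr h
    · rintro (rfl | rfl)
      · exact ⟨ha.2, Or.inl ⟨rfl, rfl⟩⟩
      · exact ⟨(hP a ha.2).1, Or.inr ⟨rfl, hm a⟩⟩
  rw [hfib, Finset.card_pair (hP a ha.2).2.symm]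

/-- Re-pair `v` with `r`, freeing the former partner of `r`. -/
noncomputable def rematch (m : V → V) (v r x : V) : V :=
  if x = v then r else if x = r then v else if x = m r then x else m x

theorem rematch_involutive {m : V → V} (hm : Function.Involutive m) {v r : V} (hv : m v = v) :
    Function.Involutive (rematch m v r) := by
  intro x
  have h1 := hm x
  have h2 := hm r
  unfold rematch
  by_cases hxv : x = v
  · subst hxv
    by_cases hr : r = x <;> simp [hr]
  by_cases hxr : x = r
  · subst hxr; simp
  by_cases hxm : x = m r
  · simp [hxm] at *
    simp [hxv, hxr]
  · have a1 : m x ≠ v := fun h => hxv (by rw [← h1, h, hv])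
    have a2 : m x ≠ r := fun h => hxm (by rw [← h, h1])
    have a3 : m x ≠ m r := fun h => hxr (hm.injective h)
    simp [hxv, hxr, hxm, a1, a2, a3, h1]

/-- Exchange argument for a matching covering maximum total weight: re-pairing an unmatched `v` with
its neighbour `r` gains `w v` and loses at most the weight of the former partner of `r`. If `r` had
no partner, nothing would be lost. -/
theorem SimpleGraph.exists_involutive_matching [Fintype V] (H : SimpleGraph V) (w : V → ℕ)
    (hw : ∀ v, 0 < w v) :
    ∃ m : V → V, Function.Involutive m ∧ (∀ v, m v ≠ v → H.Adj v (m v)) ∧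
      ∀ v r, m v = v → H.Adj v r → m r ≠ r ∧ w v ≤ w (m r) := by
  let S : Set (V → V) := {m | Function.Involutive m ∧ ∀ v, m v ≠ v → H.Adj v (m v)}
  have hS : S.Nonempty := ⟨id, fun _ => rfl, fun v h => absurd rfl h⟩
  obtain ⟨m, ⟨hm, hadj⟩, hmax⟩ := Set.exists_max_image S
    (fun m => ∑ v, if m v ≠ v then w v else 0) (Set.toFinite S) hS
  refine ⟨m, hm, hadj, fun v r hv hvr => ?_⟩
  have hne : v ≠ r := hvr.ne
  have hmem : rematch m v r ∈ S := by
    refine ⟨rematch_involutive hm hv, fun x => ?_⟩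
    unfold rematch
    split_ifs with h1 h2 h3
    · subst h1; exact fun _ => hvr
    · subst h2; exact fun _ => hvr.symm
    · exact fun h => absurd rfl h
    · exact hadj x
  have hle := hmax _ hmem
  -- Pointwise form of the exchange: the only gain is at `v`, the only possible loss at `m r`.
  have hpt : ∀ x, (if m x ≠ x then w x else 0) + (if x = v then w v else 0) ≤
      (if rematch m v r x ≠ x then w x else 0) +
        (if x = m r then (if m r ≠ r then w (m r) else 0) else 0) := by
    intro x
    by_cases hxv : x = v
    · subst hxv
      simp [hv, rematch, hne.symm]
    · by_cases hxr : x = r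
      · subst hxr
        simp only [hxv, rematch, if_true, if_false]
        rw [if_pos hne]
        split_ifs <;> omega
      · by_cases hxm : x = m r
        · have hmr : m r ≠ r := fun h => hxr (hxm.trans h)
          simp only [hxv, hxr, rematch, if_false, ← hxm, if_true]
          rw [if_pos (show x ≠ r from hxr)]
          split_ifs <;> omega
        · simp only [hxv, hxr, hxm, rematch, if_false]
          exact le_rfl
  have hsum := Finset.sum_le_sum fun x (_ : x ∈ Finset.univ) => hpt x
  rw [Finset.sum_add_distrib, Finset.sum_add_distrib, Finset.sum_ite_eq', Finset.sum_ite_eq'] at hsum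
  simp only [Finset.mem_univ, if_true] at hsum hle
  have hkey : w v ≤ if m r ≠ r then w (m r) else 0 := by omega
  split_ifs at hkey with h
  · exact ⟨h, hkey⟩
  · exact absurd hkey (by have := hw v; omega)

end Involution

/-! ### Colourings that cut as many matching edges as possible. -/

section Colouring

open scoped Classical

namespace SimpleGraph

variable {V : Type*} (G : SimpleGraph V) (m : V → V) (χ : V → Bool)

/-- The matching edges with both ends of the same colour. -/
def uncutEdges : Set (Sym2 V) := {e | ∃ u, (m u ≠ u ∧ χ u = χ (m u)) ∧ e = s(u, m u)}

variable {G m χ}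

theorem deleteUncut_adj (hm : Function.Involutive m) {u v : V} :
    (G.deleteEdges (uncutEdges m χ)).Adj u v ↔ G.Adj u v ∧ ¬ (v = m u ∧ χ u = χ v) := by
  rw [deleteEdges_adj]
  refine and_congr_right fun huv => not_congr ?_
  simp only [uncutEdges, Set.mem_ofPred_eq, Sym2.eq_iff]
  constructor
  · rintro ⟨w, ⟨-, hw⟩, ⟨rfl, rfl⟩ | ⟨rfl, rfl⟩⟩
    · exact ⟨rfl, hw⟩
    · exact ⟨(hm _).symm, hw.symm⟩
  · rintro ⟨rfl, h⟩
    exact ⟨u, ⟨huv.ne.symm, h⟩, Or.inl ⟨rfl, rfl⟩⟩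

/-- Take an admissible colouring that cuts the most matching edges. If an uncut edge joined two
different components of the graph without uncut edges, flipping the colours on one of them would
stay admissible, keep every cut edge cut and cut this edge as well. -/
theorem exists_cut_colouring [Fintype V] (hm : Function.Involutive m)
    (hadj : ∀ v, m v ≠ v → G.Adj v (m v)) :
    ∃ χ : V → Bool, (∀ u v, G.Adj u v → v ≠ m u → χ u = χ v) ∧
      ∀ u v, G.Adj u v → (G.deleteEdges (uncutEdges m χ)).Reachable u v := by
  let S : Set (V → Bool) := {χ | ∀ u v, G.Adj u v → v ≠ m u → χ u = χ v}
  have hS : S.Nonempty := ⟨fun _ => true, fun _ _ _ _ => rfl⟩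
  obtain ⟨χ, hχ, hmax⟩ := Set.exists_max_image S
    (fun χ => (Finset.univ.filter fun v => χ v ≠ χ (m v)).card) (Set.toFinite S) hS
  refine ⟨χ, hχ, fun u v huv => ?_⟩
  by_contra hnr
  have huncut : v = m u ∧ χ u = χ v := by
    by_contra hcon
    exact hnr ((deleteUncut_adj hm).2 ⟨huv, hcon⟩).reachable
  obtain ⟨rfl, hcol⟩ := huncut
  set H := G.deleteEdges (uncutEdges m χ) with hH
  have hside : ∀ a b, H.Adj a b → (H.Reachable u a ↔ H.Reachable u b) := fun a b hab =>
    ⟨fun h => h.trans hab.reachable, fun h => h.trans hab.symm.reachable⟩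
  let χ' : V → Bool := fun x => if H.Reachable u x then !χ x else χ x
  have hχ' : χ' ∈ S := by
    intro a b hab hne
    have h1 : H.Adj a b := (deleteUncut_adj hm).2 ⟨hab, fun h => hne h.1⟩
    have h2 := hside a b h1
    have h3 := hχ a b hab hne
    simp only [χ', h3, h2]
  have hlt : (Finset.univ.filter fun v => χ v ≠ χ (m v)).card <
      (Finset.univ.filter fun v => χ' v ≠ χ' (m v)).card := by
    refine Finset.card_lt_card (Finset.ssubset_iff_of_subset ?_ |>.2 ⟨u, ?_, ?_⟩)
    · intro a ha
      simp only [Finset.mem_filter, Finset.mem_univ, true_and] at ha ⊢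
      have hma : m a ≠ a := fun h => ha (by rw [h])
      have h1 : H.Adj a (m a) := (deleteUncut_adj hm).2 ⟨hadj a hma, fun h => ha h.2⟩
      have h2 := hside _ _ h1
      simp only [χ', h2]
      split_ifs
      · simpa using ha
      · exact ha
    · simp only [Finset.mem_filter, Finset.mem_univ, true_and, χ', if_neg hnr,
        if_pos (Reachable.refl (G := H) u), ← hcol]
      simp
    · simp [hcol]
  exact absurd (hmax χ' hχ') (not_le.2 hlt)

/-- If the edge were uncut, deleting it would isolate the leaf `x` from its partner, against
`hreach`. -/
theorem leaf_matching_edge_cut (hm : Function.Involutive m)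
    (hreach : ∀ u v, G.Adj u v → (G.deleteEdges (uncutEdges m χ)).Reachable u v)
    {x : V} (hx : G.Adj x (m x)) (hleaf : ∀ w, G.Adj x w → w = m x) : χ x ≠ χ (m x) := by
  intro hcol
  have key : ∀ y, (G.deleteEdges (uncutEdges m χ)).Reachable x y → x = y := by
    rintro y ⟨p⟩
    cases p with
    | nil => rfl
    | cons hadj q =>
      obtain ⟨h1, h2⟩ := (deleteUncut_adj hm).1 hadj
      obtain rfl := hleaf _ h1
      exact absurd ⟨rfl, hcol⟩ h2
  exact hx.ne (key _ (hreach x (m x) hx))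

/-- Deleting the uncut edges creates no new component, so the remaining edges alone already number
at least vertices minus components. -/
theorem card_add_uncut_le [Fintype V] (hm : Function.Involutive m)
    (hadj : ∀ v, m v ≠ v → G.Adj v (m v))
    (hreach : ∀ u v, G.Adj u v → (G.deleteEdges (uncutEdges m χ)).Reachable u v) :
    2 * Fintype.card V + (Finset.univ.filter fun v => m v ≠ v ∧ χ v = χ (m v)).card ≤
      2 * Nat.card G.ConnectedComponent + 2 * G.edgeSet.ncard := by
  have h1 := card_le_card_connectedComponent_add_ncard (G.deleteEdges (uncutEdges m χ))
  have h2 := card_connectedComponent_le_of_reachable hreach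
  have hsub : uncutEdges m χ ⊆ G.edgeSet := by
    rintro e ⟨u, ⟨hu, -⟩, rfl⟩
    exact hadj u hu
  have h3 : (G.deleteEdges (uncutEdges m χ)).edgeSet.ncard + (uncutEdges m χ).ncard =
      G.edgeSet.ncard := by
    rw [edgeSet_deleteEdges]
    exact Set.ncard_sdiff_add_ncard_of_subset hsub
  have h4 : 2 * (uncutEdges m χ).ncard =
      (Finset.univ.filter fun v => m v ≠ v ∧ χ v = χ (m v)).card := hm.two_mul_ncard_pairs (P := fun v => m v ≠ v ∧ χ v = χ (m v)) fun v hv =>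
    ⟨⟨by rw [hm v]; exact hv.1.symm, by rw [hm v]; exact hv.2.symm⟩, hv.1⟩
  rw [Nat.card_eq_fintype_card] at h1
  omega

end SimpleGraph

end Colouring

/-! ### The adversary's placement and the consequences of rigidity. -/

section Placements

open scoped Classical

variable {V : Type*}

/-- Every injective `y` with the same lengths as `x` on `G` is determined by its lengths on `F`
up to translation and reflection. -/
def RigidOver (G F : SimpleGraph V) (x : V → ℝ) : Prop :=
  ∀ y : V → ℝ, Function.Injective y → (∀ u v, G.Adj u v → |y u - y v| = |x u - x v|) →
    ∀ z : V → ℝ, Function.Injective z → (∀ u v, F.Adj u v → |z u - z v| = |y u - y v|) →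
      (∃ t, ∀ i, z i = t + y i) ∨ ∃ t, ∀ i, z i = t - y i

/-- This allows points isolated in `G` to be moved once `F` is known. -/
theorem RigidOver.congr {G F : SimpleGraph V} {x x' : V → ℝ} (h : RigidOver G F x)
    (hx : ∀ u v, G.Adj u v → |x' u - x' v| = |x u - x v|) : RigidOver G F x' :=
  fun y hy hyx => h y hy fun u v huv => (hyx u v huv).trans (hx u v huv)

/-- Paired vertices share the rank `k` and have opposite colours; the colour changes along an edge
of `G` only between paired vertices. -/
structure PairedColouring (G : SimpleGraph V) (m : V → V) (k : V → ℕ) (χ : V → Bool) : Prop where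
  involutive : Function.Involutive m
  rank_eq_iff : ∀ u v, k u = k v ↔ v = u ∨ v = m u
  cut : ∀ v, m v ≠ v → χ v ≠ χ (m v)
  uncut : ∀ u v, G.Adj u v → v ≠ m u → χ u = χ v

/-- Values in `(0, 1/4]` let offsets and integer levels be read off separately. The ratio `1/4`
makes an offset the midpoint of two others only trivially. -/
noncomputable def offset (k : V → ℕ) (v : V) : ℝ := (1 / 4) ^ (k v + 1)

noncomputable def level (χ : V → Bool) (v : V) : ℝ := if χ v then 1 else 0

noncomputable def basePlacement (k : V → ℕ) (χ : V → Bool) (v : V) : ℝ := offset k v + level χ v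

theorem exists_ne_ne [Fintype V] (hV : 3 ≤ Fintype.card V) (a v : V) : ∃ c, c ≠ a ∧ c ≠ v := by
  by_contra! hcon
  have : (Finset.univ : Finset V) ⊆ {a, v} := fun c _ => by
    by_cases hc : c = a
    · simp [hc]
    · simp [hcon c hc]
  have h1 := Finset.card_le_card this
  have h2 : ({a, v} : Finset V).card ≤ 2 := Finset.card_le_two
  rw [Finset.card_univ] at h1
  omega

theorem offset_pos (k : V → ℕ) (v : V) : 0 < offset k v := by unfold offset; positivity

theorem offset_le (k : V → ℕ) (v : V) : offset k v ≤ 1 / 4 := by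
  unfold offset
  rw [pow_succ]
  have : ((1 : ℝ) / 4) ^ k v ≤ 1 := pow_le_one₀ (by norm_num) (by norm_num)
  linarith

theorem offset_lt {k : V → ℕ} {u v : V} (h : k u < k v) : 4 * offset k v ≤ offset k u := by
  unfold offset
  have : ((1 : ℝ) / 4) ^ (k v) ≤ (1 / 4) ^ (k u + 1) :=
    pow_le_pow_of_le_one (by norm_num) (by norm_num) h
  rw [pow_succ _ (k v)]
  linarith

theorem offset_eq_iff {k : V → ℕ} {u v : V} : offset k u = offset k v ↔ k u = k v := by
  constructor
  · intro h
    by_contra hne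
    have h1 := offset_pos k u
    have h2 := offset_pos k v
    rcases lt_or_gt_of_ne hne with h3 | h3
    · have := offset_lt h3; linarith
    · have := offset_lt h3; linarith
  · intro h
    unfold offset
    rw [h]

/-- An offset larger than that of `a` is at least four times as large, already exceeding the sum. If
that of `u` is smaller, that of `v` would have to lie strictly between one and two times the offset
of `a`. -/
theorem rank_eq_of_offset_add_eq {k : V → ℕ} {a u v : V}
    (h : offset k u + offset k v = 2 * offset k a) : k u = k a := by
  by_contra hne
  have h1 := offset_pos k u
  have h2 := offset_pos k v
  have h3 := offset_pos k a
  rcases lt_or_gt_of_ne hne with h4 | h4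
  · have := offset_lt h4; linarith
  · have h5 := offset_lt h4
    rcases lt_trichotomy (k v) (k a) with h6 | h6 | h6
    · have := offset_lt h6; linarith
    · have := offset_eq_iff.2 h6; linarith
    · have := offset_lt h6; linarith

theorem level_cases (χ : V → Bool) (v : V) :
    (χ v = true ∧ level χ v = 1) ∨ (χ v = false ∧ level χ v = 0) := by
  unfold level
  cases χ v <;> simp

theorem level_add_level {χ : V → Bool} {u v : V} (h : χ u ≠ χ v) :
    level χ u + level χ v = 1 := by
  rcases level_cases χ u with ⟨h1, h2⟩ | ⟨h1, h2⟩ <;>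
    rcases level_cases χ v with ⟨h3, h4⟩ | ⟨h3, h4⟩ <;> simp_all

theorem level_congr {χ : V → Bool} {u v : V} (h : χ u = χ v) : level χ u = level χ v := by
  unfold level
  rw [h]

/-- Numbers congruent modulo one that both lie in `(0, 1/4]` are equal. -/
theorem eq_and_eq_of_add_int_eq {a b : ℝ} {p q : ℤ} (ha : 0 < a) (ha' : a ≤ 1 / 4) (hb : 0 < b)
    (hb' : b ≤ 1 / 4) (h : a + p = b + q) : a = b ∧ p = q := by
  have h1 : (p : ℝ) < q + 1 := by linarith
  have h2 : (q : ℝ) < p + 1 := by linarith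
  have h3 : p < q + 1 := by exact_mod_cast h1
  have h4 : q < p + 1 := by exact_mod_cast h2
  have h5 : p = q := by omega
  subst h5
  exact ⟨by linarith, rfl⟩

theorem exists_int_level (χ : V → Bool) (v : V) : ∃ p : ℤ, level χ v = p := by
  rcases level_cases χ v with ⟨-, h⟩ | ⟨-, h⟩
  · exact ⟨1, by simp [h]⟩
  · exact ⟨0, by simp [h]⟩

namespace PairedColouring

variable {G F : SimpleGraph V} {m : V → V} {k : V → ℕ} {χ : V → Bool}

theorem offset_mate (h : PairedColouring G m k χ) (v : V) : offset k (m v) = offset k v :=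
  offset_eq_iff.2 ((h.rank_eq_iff _ _).2 (Or.inr (h.involutive v).symm))

/-- A placement with the offsets of `k` and integer levels that differ on paired vertices is
injective. -/
theorem injective_of_level (h : PairedColouring G m k χ) (l : V → ℤ)
    (hl : ∀ v, m v ≠ v → l v ≠ l (m v)) : Function.Injective fun v => offset k v + l v := by
  intro u v huv
  obtain ⟨h1, h2⟩ := eq_and_eq_of_add_int_eq (offset_pos k u) (offset_le k u) (offset_pos k v)
    (offset_le k v) huv
  rcases (h.rank_eq_iff u v).1 (offset_eq_iff.1 h1) with h3 | h3
  · exact h3.symm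
  · subst h3
    by_contra hne
    exact hl u (fun h => hne h.symm) h2

theorem basePlacement_injective (h : PairedColouring G m k χ) :
    Function.Injective (basePlacement k χ) := by
  choose l hl using exists_int_level χ
  have heq : basePlacement k χ = fun v => offset k v + l v := by
    funext v
    rw [basePlacement, hl]
  rw [heq]
  refine h.injective_of_level l fun v hv hcon => ?_
  have h1 := level_add_level (h.cut v hv)
  have h2 : (l v : ℝ) + l (m v) = 1 := by rw [← hl, ← hl]; exact h1
  rw [hcon] at h2
  have h3 : l (m v) + l (m v) = 1 := by exact_mod_cast h2
  omega

theorem abs_basePlacement_sub_mate (h : PairedColouring G m k χ) {v : V} (hv : m v ≠ v) :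
    |basePlacement k χ v - basePlacement k χ (m v)| = 1 := by
  unfold basePlacement
  rw [h.offset_mate]
  rcases level_cases χ v with ⟨h1, h2⟩ | ⟨h1, h2⟩ <;>
    rcases level_cases χ (m v) with ⟨h3, h4⟩ | ⟨h3, h4⟩
  · exact absurd (h1.trans h3.symm) (h.cut v hv)
  · rw [h2, h4]; norm_num
  · rw [h2, h4]; norm_num
  · exact absurd (h1.trans h3.symm) (h.cut v hv)

def matchingEdges (m : V → V) : Set (Sym2 V) := {e | ∃ v, m v ≠ v ∧ e = s(v, m v)}

/-- Otherwise every edge of `F` leaving the component of `a` is a pair edge. Reflecting the levels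
on that side keeps all `G`-lengths, since levels differ along `G` only within pairs. It may change
lengths of `F`, so two reflected placements are compared with each other and not with the base one.
They differ by a shift of the side by 2, under which each crossing difference goes from `1` to `-1`,
so all `F`-lengths agree. -/
theorem deleteMatching_preconnected [Fintype V] (hV : 3 ≤ Fintype.card V)
    (h : PairedColouring G m k χ) (hGF : G ≤ F) (hrig : RigidOver G F (basePlacement k χ)) :
    (F.deleteEdges (matchingEdges m)).Preconnected := by
  set H := F.deleteEdges (matchingEdges m) with hH
  intro a b
  by_contra hab
  have hcross : ∀ u v, F.Adj u v → H.Reachable a u → ¬ H.Reachable a v → v = m u ∧ m u ≠ u := by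
    intro u v huv hu hv
    by_contra hcon
    refine hv (hu.trans (SimpleGraph.Adj.reachable ?_))
    rw [hH, SimpleGraph.deleteEdges_adj]
    refine ⟨huv, ?_⟩
    rintro ⟨w, hw, he⟩
    rw [Sym2.eq_iff] at he
    rcases he with ⟨rfl, rfl⟩ | ⟨rfl, rfl⟩
    · exact hcon ⟨rfl, hw⟩
    · exact hcon ⟨(h.involutive _).symm, by rw [h.involutive]; exact hw.symm⟩
  choose l hl using exists_int_level χ
  have hsum : ∀ v, m v ≠ v → l v + l (m v) = 1 := by
    intro v hv
    have h1 := level_add_level (h.cut v hv)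
    rw [hl, hl] at h1
    exact_mod_cast h1
  have hsame : ∀ u v, G.Adj u v → v ≠ m u → l u = l v := by
    intro u v huv hne
    have h1 := level_congr (h.uncut u v huv hne)
    rw [hl, hl] at h1
    exact_mod_cast h1
  -- the levels are reflected on the side of `a`, about `1` in `lx` and about `0` in `ly`
  let lx : V → ℤ := fun v => if H.Reachable a v then 2 - l v else l v
  let ly : V → ℤ := fun v => if H.Reachable a v then -l v else l v
  have hcrossx : ∀ u v, F.Adj u v → H.Reachable a u → ¬ H.Reachable a v →
      |offset k u + lx u - (offset k v + lx v)| = 1 ∧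
      |offset k u + ly u - (offset k v + ly v)| = 1 := by
    intro u v huv hu hv
    obtain ⟨rfl, hm⟩ := hcross u v huv hu hv
    have h1 : (l u : ℝ) + l (m u) = 1 := by exact_mod_cast hsum u hm
    rw [h.offset_mate]
    simp only [lx, ly, if_pos hu, if_neg hv]
    push_cast
    constructor
    · rw [show offset k u + (2 - (l u : ℝ)) - (offset k u + l (m u)) = 1 by linarith, abs_one]
    · rw [show offset k u + -(l u : ℝ) - (offset k u + l (m u)) = -1 by linarith, abs_neg, abs_one]
  have hbase : ∀ u, basePlacement k χ u = offset k u + l u := fun u => by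
    rw [basePlacement, hl]
  have hx : Function.Injective fun v => offset k v + (lx v : ℝ) := by
    refine h.injective_of_level lx fun v hv => ?_
    have := hsum v hv
    simp only [lx]
    split_ifs <;> omega
  have hy : Function.Injective fun v => offset k v + (ly v : ℝ) := by
    refine h.injective_of_level ly fun v hv => ?_
    have := hsum v hv
    simp only [ly]
    split_ifs <;> omega
  have hxG : ∀ u v, G.Adj u v → |offset k u + (lx u : ℝ) - (offset k v + lx v)| =
      |basePlacement k χ u - basePlacement k χ v| := by
    intro u v huv
    by_cases hu : H.Reachable a u <;> by_cases hv : H.Reachable a v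
    · by_cases hne : v = m u
      · subst hne
        rw [hbase, hbase, h.offset_mate, ← abs_neg]
        simp only [lx, if_pos hu, if_pos hv]
        push_cast
        congr 1
        ring
      · have h2 := hsame u v huv hne
        rw [hbase, hbase]
        simp only [lx, if_pos hu, if_pos hv, h2]
        push_cast
        congr 1
        ring
    · obtain ⟨rfl, hm⟩ := hcross u v (hGF huv) hu hv
      rw [(hcrossx _ _ (hGF huv) hu hv).1, h.abs_basePlacement_sub_mate hm]
    · obtain ⟨rfl, hm⟩ := hcross v u (hGF huv.symm) hv hu
      rw [abs_sub_comm, (hcrossx _ _ (hGF huv.symm) hv hu).1, abs_sub_comm,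
        h.abs_basePlacement_sub_mate hm]
    · rw [hbase, hbase]
      simp only [lx, if_neg hu, if_neg hv]
  have hyF : ∀ u v, F.Adj u v → |offset k u + (ly u : ℝ) - (offset k v + ly v)| =
      |offset k u + (lx u : ℝ) - (offset k v + lx v)| := by
    intro u v huv
    by_cases hu : H.Reachable a u <;> by_cases hv : H.Reachable a v
    · simp only [lx, ly, if_pos hu, if_pos hv]
      push_cast
      congr 1
      ring
    · have := hcrossx _ _ huv hu hv
      rw [this.1, this.2]
    · have := hcrossx _ _ huv.symm hv hu
      rw [abs_sub_comm, this.2, abs_sub_comm, this.1]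
    · simp only [lx, ly, if_neg hu, if_neg hv]
  have haa : H.Reachable a a := SimpleGraph.Reachable.refl _
  rcases hrig _ hx hxG _ hy hyF with ⟨t, ht⟩ | ⟨t, ht⟩
  · have h1 := ht a
    have h2 := ht b
    simp only [lx, ly, if_pos haa, if_neg hab] at h1 h2
    push_cast at h1
    linarith
  -- A third point `c` lies on the side of `a` or of `b`. Each side is only translated, so a global
  -- reflection would make `c` coincide with that point.
  · obtain ⟨c, hca, hcb⟩ : ∃ c, c ≠ a ∧ c ≠ b := exists_ne_ne hV a b
    have h3 := ht c
    by_cases hc : H.Reachable a c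
    · have h1 := ht a
      refine hca (hx ?_)
      simp only [lx, ly, if_pos haa, if_pos hc] at h1 h3 ⊢
      push_cast at h1 h3 ⊢
      linarith
    · have h1 := ht b
      refine hcb (hx ?_)
      simp only [lx, ly, if_neg hab, if_neg hc] at h1 h3 ⊢
      linarith

/-- If `a` were the only possible neighbour of `v`, reflecting `v` alone in `a` would preserve all
lengths of `F`. -/
theorem exists_adj_ne [Fintype V] (hV : 3 ≤ Fintype.card V) (h : PairedColouring G m k χ)
    (hrig : RigidOver G F (basePlacement k χ)) {v a : V} (hv : m v = v) (ha : a ≠ v) :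
    ∃ w, w ≠ a ∧ F.Adj v w := by
  by_contra! hcon
  set x := basePlacement k χ with hxdef
  have hxinj : Function.Injective x := h.basePlacement_injective
  -- The mirror image of `v` is not an occupied position: the integer levels cancel, and the offsets
  -- would then give `v` the rank of `a`, although `v` is unpaired.
  have hmid : ∀ q, x v + x q ≠ 2 * x a := by
    intro q hq
    have hva : k v ≠ k a := by
      intro hk
      rcases (h.rank_eq_iff v a).1 hk with h1 | h1
      · exact ha h1
      · exact ha (h1.trans hv)
    obtain ⟨p1, hp1⟩ := exists_int_level χ v
    obtain ⟨p2, hp2⟩ := exists_int_level χ q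
    obtain ⟨p3, hp3⟩ := exists_int_level χ a
    simp only [hxdef, basePlacement, hp1, hp2, hp3] at hq
    have b1 := offset_pos k v
    have b2 := offset_pos k q
    have b3 := offset_pos k a
    have c1 := offset_le k v
    have c2 := offset_le k q
    have c3 := offset_le k a
    have d1 : (p1 + p2 : ℝ) < 2 * p3 + 1 := by linarith
    have d2 : (2 * p3 : ℝ) < p1 + p2 + 1 := by linarith
    have d3 : p1 + p2 < 2 * p3 + 1 := by exact_mod_cast d1
    have d4 : 2 * p3 < p1 + p2 + 1 := by exact_mod_cast d2
    have d5 : p1 + p2 = 2 * p3 := by omega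
    have d6 : (p1 + p2 : ℝ) = 2 * p3 := by exact_mod_cast d5
    exact hva (rank_eq_of_offset_add_eq (v := q) (by linarith))
  let z : V → ℝ := fun u => if u = v then 2 * x a - x v else x u
  have hzv : z v = 2 * x a - x v := if_pos rfl
  have hz : ∀ u, u ≠ v → z u = x u := fun u hu => if_neg hu
  have hzinj : Function.Injective z := by
    intro p q hpq
    by_cases hp : p = v <;> by_cases hq : q = v
    · rw [hp, hq]
    · rw [hp, hzv, hz q hq] at hpq
      exact absurd (by linarith) (hmid q)
    · rw [hq, hzv, hz p hp] at hpq
      exact absurd (by linarith) (hmid p)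
    · rw [hz p hp, hz q hq] at hpq
      exact hxinj hpq
  have hedge : ∀ w, F.Adj v w → |z v - z w| = |x v - x w| := by
    intro w hw
    obtain rfl : w = a := by
      by_contra hne
      exact hcon w hne hw
    rw [hzv, hz w ha, ← abs_neg]
    congr 1
    ring
  have hzF : ∀ p q, F.Adj p q → |z p - z q| = |x p - x q| := by
    intro p q hpq
    by_cases hp : p = v
    · subst hp; exact hedge q hpq
    · by_cases hq : q = v
      · subst hq
        rw [abs_sub_comm, hedge p hpq.symm, abs_sub_comm]
      · rw [hz p hp, hz q hq]
  obtain ⟨c, hca, hcv⟩ : ∃ c, c ≠ a ∧ c ≠ v := exists_ne_ne hV a v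
  rcases hrig x hxinj (fun _ _ _ => rfl) z hzinj hzF with ⟨t, ht⟩ | ⟨t, ht⟩
  · have h1 := ht a
    have h2 := ht v
    rw [hz a ha] at h1
    rw [hzv] at h2
    exact ha (hxinj (by linarith))
  · have h1 := ht a
    have h2 := ht c
    rw [hz a ha] at h1
    rw [hz c hcv] at h2
    exact hca (hxinj (by linarith))

end PairedColouring

end Placements

/-! ### Choosing the matching, and extending its cut part by second-round edges. -/

section Extension

open scoped Classical

variable {V : Type*} {G F : SimpleGraph V}

/-- A matching `m` of `G` of maximum weight (leaves counting double), and a colouring `χ` constant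
along the edges outside `m`, such that the matching edges with ends of the same colour can be
deleted without disconnecting their ends. -/
structure CutMatching (G : SimpleGraph V) [Fintype V] (m : V → V) (χ : V → Bool) : Prop where
  involutive : Function.Involutive m
  adj : ∀ v, m v ≠ v → G.Adj v (m v)
  matched_of_adj : ∀ v r, m v = v → G.Adj v r → m r ≠ r
  leaf_of_adj : ∀ v r, m v = v → G.Adj v r → G.degree v = 1 → G.degree (m r) = 1
  uncut : ∀ u v, G.Adj u v → v ≠ m u → χ u = χ v
  reachable : ∀ u v, G.Adj u v →
    (G.deleteEdges (SimpleGraph.uncutEdges m χ)).Reachable u v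

/-- With weight 2 on leaves and 1 elsewhere, the exchange inequality at an unmatched leaf forces the
partner of its neighbour to be a leaf too. -/
theorem exists_cutMatching [Fintype V] (G : SimpleGraph V) :
    ∃ m χ, CutMatching G m χ := by
  obtain ⟨m, hm, hadj, hmax⟩ := G.exists_involutive_matching
    (fun v => if G.degree v = 1 then 2 else 1) (fun v => by split_ifs <;> norm_num)
  obtain ⟨χ, h1, h2⟩ := SimpleGraph.exists_cut_colouring hm hadj
  refine ⟨m, χ, hm, hadj, fun v r hv hvr => (hmax v r hv hvr).1, fun v r hv hvr hd => ?_, h1, h2⟩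
  have h3 := (hmax v r hv hvr).2
  simp only [hd, if_true] at h3
  by_contra h4
  rw [if_neg h4] at h3
  omega

/-- The partner of `v` along a matching edge with ends of different colours, else `v`. -/
noncomputable def cutMate (m : V → V) (χ : V → Bool) (v : V) : V :=
  if χ v ≠ χ (m v) then m v else v

theorem cutMate_ne_iff {m : V → V} {χ : V → Bool} {v : V} :
    cutMate m χ v ≠ v ↔ χ v ≠ χ (m v) := by
  unfold cutMate
  split_ifs with h
  · exact ⟨fun _ => h, fun _ hv => h (by rw [hv])⟩
  · simp [h]

theorem cutMate_eq {m : V → V} {χ : V → Bool} {v : V} (h : cutMate m χ v ≠ v) :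
    cutMate m χ v = m v :=
  if_pos (cutMate_ne_iff.1 h)

theorem cutMate_involutive {m : V → V} {χ : V → Bool} (hm : Function.Involutive m) :
    Function.Involutive (cutMate m χ) := by
  intro v
  by_cases h : χ v = χ (m v)
  · have h1 : cutMate m χ v = v := if_neg (not_not.2 h)
    rw [h1, h1]
  · have h1 : cutMate m χ v = m v := if_pos h
    have h2 : cutMate m χ (m v) = m (m v) := if_pos (by rw [hm v]; exact fun h' => h h'.symm)
    rw [h1, h2, hm v]

theorem rank_eq_iff_of_mem {m : V → V} (hm : Function.Involutive m) {r k : V → ℕ}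
    (hr : Function.Injective r) (hk : ∀ v, k (m v) = k v) (hmem : ∀ v, k v = r v ∨ k v = r (m v))
    (u v : V) : k u = k v ↔ v = u ∨ v = m u := by
  constructor
  · intro h
    have hm' := hm.injective
    rcases hmem u with h1 | h1 <;> rcases hmem v with h2 | h2
    · exact Or.inl (hr (by omega))
    · exact Or.inr (hm' (by rw [hm u]; exact hr (by omega)))
    · exact Or.inr (hr (by omega))
    · exact Or.inl (hm' (hr (by omega)))
  · rintro (rfl | rfl)
    · rfl
    · exact (hk u).symm

noncomputable def minRank (r : V → ℕ) (m : V → V) (v : V) : ℕ := min (r v) (r (m v))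

theorem CutMatching.pairedColouring [Fintype V] {m : V → V} {χ : V → Bool}
    (h : CutMatching G m χ) {r : V → ℕ} (hr : Function.Injective r) :
    PairedColouring G (cutMate m χ) (minRank r (cutMate m χ)) χ where
  involutive := cutMate_involutive h.involutive
  rank_eq_iff := rank_eq_iff_of_mem (cutMate_involutive h.involutive) hr
    (fun v => by unfold minRank; rw [cutMate_involutive h.involutive, min_comm])
    (fun v => min_choice _ _)
  cut v hv := by
    rw [cutMate_eq hv]
    exact cutMate_ne_iff.1 hv
  uncut u v huv hne := by
    by_contra hcol
    by_cases hvm : v = m u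
    · subst hvm
      exact hne (if_pos hcol).symm
    · exact hcol (h.uncut u v huv hvm)

/-- `v` has no neighbour in `G`. -/
def SimpleGraph.IsolatedVertex (G : SimpleGraph V) (v : V) : Prop := ∀ w, ¬ G.Adj v w

/-- The rank shared by the pair of `v`, which is the rank of its only non-isolated member if there
is exactly one. -/
noncomputable def pairRank (G : SimpleGraph V) (r : V → ℕ) (m : V → V) (v : V) : ℕ :=
  if G.IsolatedVertex v ∧ ¬ G.IsolatedVertex (m v) then r (m v)
  else if ¬ G.IsolatedVertex v ∧ G.IsolatedVertex (m v) then r v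
  else min (r v) (r (m v))

/-- Recolouring of the isolated vertices that makes them differ from their partners. -/
noncomputable def pairColour (G : SimpleGraph V) (r : V → ℕ) (m : V → V) (χ : V → Bool) (v : V) :
    Bool :=
  if G.IsolatedVertex v then
    if G.IsolatedVertex (m v) then decide (r v < r (m v)) else !χ (m v)
  else χ v

/-- `p` extends the cut part of the matching by edges of `F` at isolated vertices of `G`. -/
structure MateExtension (G F : SimpleGraph V) (mt p : V → V) : Prop where
  involutive : Function.Involutive p
  eq_of_ne : ∀ v, mt v ≠ v → p v = mt v
  adj : ∀ v, p v ≠ v → F.Adj v (p v)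
  isolated : ∀ v, mt v = v → p v ≠ v → G.IsolatedVertex v ∨ G.IsolatedVertex (p v)
  matched_of_adj : ∀ v w, G.IsolatedVertex v → p v = v → F.Adj v w → p w ≠ w

theorem CutMatching.adj_cutMate [Fintype V] {m : V → V} {χ : V → Bool} (h : CutMatching G m χ)
    {v : V} (hv : cutMate m χ v ≠ v) : G.Adj v (cutMate m χ v) := by
  have h1 := cutMate_eq hv
  rw [h1] at hv ⊢
  exact h.adj v hv

/-- The cut pairs are kept. Among the remaining vertices, a maximum matching is taken in the edges
of `F` that have an end isolated in `G`, and its maximality yields `matched_of_adj`. -/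
theorem CutMatching.exists_mateExtension [Fintype V] {m : V → V} {χ : V → Bool}
    (h : CutMatching G m χ) (hGF : G ≤ F) : ∃ p, MateExtension G F (cutMate m χ) p := by
  set mt := cutMate m χ with hmt
  have hinv : Function.Involutive mt := cutMate_involutive h.involutive
  let H : SimpleGraph V :=
    { Adj := fun v w => F.Adj v w ∧ mt v = v ∧ mt w = w ∧
        (G.IsolatedVertex v ∨ G.IsolatedVertex w)
      symm := ⟨fun v w hvw => ⟨hvw.1.symm, hvw.2.2.1, hvw.2.1, hvw.2.2.2.symm⟩⟩
      loopless := ⟨fun v hv => hv.1.ne rfl⟩ }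
  obtain ⟨q, hq, hadj, hmax⟩ := H.exists_involutive_matching (fun _ => 1) (fun _ => one_pos)
  have hfix : ∀ v, mt v ≠ v → q v = v := by
    intro v hv
    by_contra hne
    exact hv (hadj v hne).2.1
  have hfix' : ∀ v, mt v = v → mt (q v) = q v := by
    intro v hv
    by_cases hne : q v = v
    · rw [hne, hv]
    · exact (hadj v hne).2.2.1
  refine ⟨fun v => if mt v ≠ v then mt v else q v, ?_, ?_, ?_, ?_, ?_⟩
  · intro v
    by_cases hv : mt v = v
    · simp only [hv, ne_eq, not_true_eq_false, if_false, hfix' v hv]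
      exact hq v
    · have : mt (mt v) ≠ mt v := by rw [hinv v]; exact fun h' => hv h'.symm
      simp only [ne_eq, hv, not_false_eq_true, if_true, this]
      exact hinv v
  · intro v hv
    simp only [if_pos hv]
  · intro v hv
    by_cases h1 : mt v = v
    · simp only [h1, ne_eq, not_true_eq_false, if_false] at hv ⊢
      exact (hadj v hv).1
    · simp only [ne_eq, h1, not_false_eq_true, if_true]
      exact hGF (h.adj_cutMate h1)
  · intro v h1 hv
    simp only [h1, ne_eq, not_true_eq_false, if_false] at hv ⊢
    exact (hadj v hv).2.2.2
  · intro v w hiso hv hvw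
    have h1 : mt v = v := by
      by_contra h1
      exact hiso _ (h.adj_cutMate h1)
    simp only [h1, ne_eq, not_true_eq_false, if_false] at hv
    by_cases h2 : mt w = w
    · simp only [h2, ne_eq, not_true_eq_false, if_false]
      exact (hmax v w hv ⟨hvw, h1, h2, Or.inl hiso⟩).1
    · simp only [ne_eq, h2, not_false_eq_true, if_true]

variable {m p : V → V} {χ : V → Bool} {r : V → ℕ}

theorem MateExtension.cutMate_ne (hp : MateExtension G F (cutMate m χ) p) {v : V}
    (h1 : ¬ G.IsolatedVertex v) (h2 : ¬ G.IsolatedVertex (p v)) (h3 : p v ≠ v) :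
    cutMate m χ v ≠ v := by
  intro hv
  rcases hp.isolated v hv h3 with h4 | h4
  · exact h1 h4
  · exact h2 h4

variable [Fintype V]

theorem CutMatching.not_isolated (h : CutMatching G m χ) {v : V} (hv : cutMate m χ v ≠ v) : ¬ G.IsolatedVertex v :=
  fun hiso => hiso _ (h.adj_cutMate hv)

theorem MateExtension.pairRank_eq (h : CutMatching G m χ)
    (hp : MateExtension G F (cutMate m χ) p) {v : V} (hv : ¬ G.IsolatedVertex v) :
    pairRank G r p v = minRank r (cutMate m χ) v := by
  unfold pairRank minRank
  rw [if_neg (fun h => hv h.1)]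
  by_cases h1 : cutMate m χ v = v
  · rw [h1, min_self]
    split_ifs with h2
    · rfl
    · by_cases h3 : p v = v
      · rw [h3, min_self]
      · rcases hp.isolated v h1 h3 with h4 | h4
        · exact absurd h4 hv
        · exact absurd ⟨hv, h4⟩ h2
  · have h2 := hp.eq_of_ne v h1
    have h3 : ¬ G.IsolatedVertex (p v) := by
      rw [h2]
      refine fun hiso => hiso v (h.adj_cutMate h1).symm
    rw [if_neg (fun h => h3 h.2), h2]

theorem MateExtension.pairedColouring (h : CutMatching G m χ)
    (hp : MateExtension G F (cutMate m χ) p) (hr : Function.Injective r) :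
    PairedColouring G p (pairRank G r p) (pairColour G r p χ) where
  involutive := hp.involutive
  rank_eq_iff := by
    refine rank_eq_iff_of_mem hp.involutive hr (fun v => ?_) (fun v => ?_)
    · unfold pairRank
      rw [hp.involutive v, min_comm]
      split_ifs <;> first | rfl | tauto
    · unfold pairRank
      split_ifs
      · exact Or.inr rfl
      · exact Or.inl rfl
      · exact min_choice _ _
  cut v hv := by
    unfold pairColour
    rw [hp.involutive v]
    by_cases h1 : G.IsolatedVertex v <;> by_cases h2 : G.IsolatedVertex (p v)
    · simp only [h1, h2, if_true]
      have : r v ≠ r (p v) := fun h => hv (hr h).symm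
      rw [Ne, decide_eq_decide]
      omega
    · simp [h1, h2]
    · simp [h1, h2]
    · simp only [h1, h2, if_false]
      have h3 := hp.cutMate_ne h1 h2 hv
      rw [hp.eq_of_ne v h3, cutMate_eq h3]
      exact cutMate_ne_iff.1 h3
  uncut u v huv hne := by
    have h1 : ¬ G.IsolatedVertex u := fun hiso => hiso v huv
    have h2 : ¬ G.IsolatedVertex v := fun hiso => hiso u huv.symm
    simp only [pairColour, h1, h2, if_false]
    refine (h.pairedColouring hr).uncut u v huv fun hvm => hne ?_
    subst hvm
    exact (hp.eq_of_ne u huv.ne.symm).symm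

/-- The new ranks and colours move only points isolated in `G`, so the first-round lengths do not
change. -/
theorem MateExtension.rigidOver (h : CutMatching G m χ)
    (hp : MateExtension G F (cutMate m χ) p)
    (hrig : RigidOver G F (basePlacement (minRank r (cutMate m χ)) χ)) :
    RigidOver G F (basePlacement (pairRank G r p) (pairColour G r p χ)) := by
  have key : ∀ v, ¬ G.IsolatedVertex v →
      basePlacement (pairRank G r p) (pairColour G r p χ) v =
        basePlacement (minRank r (cutMate m χ)) χ v := by
    intro v hv
    unfold basePlacement offset level
    rw [hp.pairRank_eq h hv, pairColour, if_neg hv]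
  refine hrig.congr fun u v huv => ?_
  rw [key u fun hiso => hiso v huv, key v fun hiso => hiso u huv.symm]

end Extension

/-! ### Counting edges of `G`, components of `G` and edges of `F \ G`. -/

section Counting

open scoped Classical

variable {V : Type*} {G F : SimpleGraph V} {m p : V → V} {χ : V → Bool}

/-- Isolated vertices of `G` that stay unpaired. -/
def UnpairedIsolated (G : SimpleGraph V) (p : V → V) (v : V) : Prop :=
  G.IsolatedVertex v ∧ p v = v

theorem MateExtension.sdiff_adj_mate (hp : MateExtension G F (cutMate m χ) p) {v : V}
    (hv : cutMate m χ v = v) (hne : p v ≠ v) :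
    (F \ G).Adj v (p v) ∧ ¬ UnpairedIsolated G p (p v) := by
  refine ⟨⟨hp.adj v hne, fun hadj => ?_⟩, fun h => hne ?_⟩
  · rcases hp.isolated v hv hne with h | h
    · exact h _ hadj
    · exact h _ hadj.symm
  · rw [← h.2, hp.involutive v]

variable [Fintype V]

theorem SimpleGraph.sum_sum_adj_eq (G : SimpleGraph V) :
    ∑ v, ∑ w, (if G.Adj v w then 1 else 0) = 2 * G.edgeSet.ncard := by
  have h := G.sum_degrees_eq_twice_card_edges
  rw [Set.ncard_eq_toFinset_card']
  rw [show G.edgeSet.toFinset = G.edgeFinset from rfl, ← h]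
  refine Finset.sum_congr rfl fun v _ => ?_
  rw [← G.card_neighborFinset_eq_degree, G.neighborFinset_eq_filter, Finset.card_filter]

theorem SimpleGraph.sum_adj_eq_degree (G : SimpleGraph V) (v : V) :
    ∑ w, (if G.Adj v w then 1 else 0) = G.degree v := by
  rw [← G.card_neighborFinset_eq_degree, G.neighborFinset_eq_filter, Finset.card_filter]

theorem SimpleGraph.degree_eq_zero_iff_isolatedVertex (v : V) :
    G.degree v = 0 ↔ G.IsolatedVertex v := by
  rw [← G.sum_adj_eq_degree, Finset.sum_eq_zero_iff]
  simp [SimpleGraph.IsolatedVertex]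

theorem SimpleGraph.eq_of_degree_eq_one {v a b : V} (h : G.degree v = 1) (ha : G.Adj v a)
    (hb : G.Adj v b) : a = b := by
  rw [← G.card_neighborFinset_eq_degree] at h
  exact Finset.card_le_one.1 h.le a (by simpa using ha) b (by simpa using hb)

/-- Unmatched vertices are pairwise non-adjacent, so each edge at one of them has a single unmatched
end and is not a matching edge. The proof counts ordered pairs. -/
theorem CutMatching.sum_degree_le (h : CutMatching G m χ) :
    (Finset.univ.filter fun v => m v ≠ v).card + 2 * ∑ v, (if m v = v then G.degree v else 0) ≤
      2 * G.edgeSet.ncard := by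
  rw [← G.sum_sum_adj_eq]
  have hpt : ∀ v w, (if w = m v then (if m v ≠ v then 1 else 0) else 0) +
      (if m v = v then (if G.Adj v w then 1 else 0) else 0) +
      (if m w = w then (if G.Adj w v then 1 else 0) else 0) ≤ if G.Adj v w then 1 else 0 := by
    intro v w
    have h1 := h.adj v
    have h2 := h.matched_of_adj v w
    have h3 := h.matched_of_adj w v
    have h4 := h.involutive v
    rw [G.adj_comm w v] at *
    by_cases h5 : w = m v
    · subst h5
      by_cases h6 : m v = v
      · simp [h6]
      · have h7 : ¬ m (m v) = m v := by rw [h4]; exact fun h => h6 h.symm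
        simp [h6, h7, h1 h6]
    · by_cases h6 : G.Adj v w
      · by_cases h7 : m v = v
        · simp [h6, h7, h2 h7 h6]
        · simp [h5, h6, h7]
          split_ifs <;> simp
      · simp [h5, h6]
  have hsum := Finset.sum_le_sum fun v (_ : v ∈ Finset.univ) =>
    Finset.sum_le_sum fun w (_ : w ∈ Finset.univ) => hpt v w
  refine le_trans (le_of_eq ?_) hsum
  simp only [Finset.sum_add_distrib]
  rw [Finset.sum_comm (f := fun v w => if m w = w then (if G.Adj w v then 1 else 0) else 0)]
  have hin : ∀ v, ∑ w, (if m v = v then (if G.Adj v w then 1 else 0) else 0) =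
      if m v = v then G.degree v else 0 := by
    intro v
    split_ifs
    · exact G.sum_adj_eq_degree v
    · simp
  simp only [hin, Finset.sum_ite_eq', Finset.mem_univ, if_true,
    Finset.card_filter]
  ring

/-- Components of `G` without isolated vertices and without cut matching edges. -/
def UncutComponent (G : SimpleGraph V) (mt : V → V) (K : G.ConnectedComponent) : Prop :=
  ∀ v, G.connectedComponentMk v = K → ¬ G.IsolatedVertex v ∧ mt v = v

/-- A component that is not uncut contains an isolated vertex, of weight 2, or both ends of a cut
edge, of weight 1 each. -/
theorem CutMatching.two_mul_card_component_le (h : CutMatching G m χ) :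
    2 * Nat.card G.ConnectedComponent ≤
      2 * (Finset.univ.filter fun v => G.IsolatedVertex v).card +
      (Finset.univ.filter fun v => cutMate m χ v ≠ v).card +
      2 * (Finset.univ.filter fun K => UncutComponent G (cutMate m χ) K).card := by
  set mt := cutMate m χ with hmt
  have hpt : ∀ K : G.ConnectedComponent, 2 ≤ 2 * (if UncutComponent G mt K then 1 else 0) +
      ∑ v with G.connectedComponentMk v = K,
        (2 * (if G.IsolatedVertex v then 1 else 0) + if mt v ≠ v then 1 else 0) := by
    intro K
    by_cases hK : UncutComponent G mt K
    · simp [hK]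
    · rw [UncutComponent] at hK
      push Not at hK
      obtain ⟨v, hv, hbad⟩ := hK
      by_cases h1 : G.IsolatedVertex v
      · refine le_add_left (le_trans ?_ (Finset.single_le_sum (fun _ _ => Nat.zero_le _)
          (Finset.mem_filter.2 ⟨Finset.mem_univ v, hv⟩)))
        simp [h1]
      · have h2 : mt v ≠ v := hbad h1
        have h3 : mt (mt v) ≠ mt v := by
          rw [hmt, cutMate_involutive h.involutive v]; exact h2.symm
        have h4 : G.connectedComponentMk (mt v) = K := by
          rw [← hv, SimpleGraph.ConnectedComponent.eq]
          exact (h.adj_cutMate h2).symm.reachable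
        refine le_add_left (le_trans ?_ (Finset.sum_le_sum_of_subset
          (s := ({v, mt v} : Finset V)) ?_))
        · rw [Finset.sum_pair h2.symm, if_pos h2, if_pos h3]
          omega
        · intro x hx
          simp only [Finset.mem_insert, Finset.mem_singleton] at hx
          rcases hx with rfl | rfl
          · simpa using hv
          · simpa using h4
  have hsum := Finset.sum_le_sum fun K (_ : K ∈ Finset.univ) => hpt K
  have hfib : ∀ f : V → ℕ, ∑ K, ∑ v with G.connectedComponentMk v = K, f v = ∑ v, f v := by
    intro f
    convert Finset.sum_fiberwise Finset.univ G.connectedComponentMk f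
  rw [Finset.sum_add_distrib, hfib, Finset.sum_add_distrib, ← Finset.mul_sum,
    ← Finset.mul_sum, ← Finset.card_filter, ← Finset.card_filter, ← Finset.card_filter,
    Finset.sum_const, Finset.card_univ, smul_eq_mul, ← Nat.card_eq_fintype_card] at hsum
  omega

theorem one_le_sum_indicator {Q : V → Prop} [DecidablePred Q] {w : V} (h : Q w) : 1 ≤ ∑ w, if Q w then 1 else 0 := by
  refine le_trans ?_ (Finset.single_le_sum (fun _ _ => Nat.zero_le _) (Finset.mem_univ w))
  rw [if_pos h]

theorem two_le_sum_indicator {Q : V → Prop} [DecidablePred Q] {w w' : V} (hne : w ≠ w') (h : Q w) (h' : Q w') :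
    2 ≤ ∑ w, if Q w then 1 else 0 := by
  refine le_trans ?_ (Finset.sum_le_sum_of_subset (Finset.subset_univ {w, w'}))
  rw [Finset.sum_pair hne, if_pos h, if_pos h']

/-- Vertices of uncut components joined by `F \ G` to a vertex that is not unpaired isolated. -/
def UncutExit (G F : SimpleGraph V) (mt p : V → V) (v : V) : Prop :=
  UncutComponent G mt (G.connectedComponentMk v) ∧
    ∃ w, (F \ G).Adj v w ∧ ¬ UnpairedIsolated G p w

theorem MateExtension.card_uncutComponent_le (hp : MateExtension G F (cutMate m χ) p)
    (hF : F.Preconnected) :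
    (Finset.univ.filter fun K => UncutComponent G (cutMate m χ) K).card ≤
      (Finset.univ.filter fun v => UncutExit G F (cutMate m χ) p v).card + 1 := by
  -- A single uncut component may have no exit, whence the `+ 1`. With two or more, connectedness of
  -- `F` gives each a leaving edge. If that edge ends at an unpaired isolated point, its start is
  -- paired, and the pair edge serves instead.
  by_cases hle : (Finset.univ.filter fun K => UncutComponent G (cutMate m χ) K).card ≤ 1
  · omega
  refine le_trans ?_ (Nat.le_succ _)
  refine le_trans (Finset.card_le_card (t := (Finset.univ.filter fun v =>
    UncutExit G F (cutMate m χ) p v).image G.connectedComponentMk) ?_) Finset.card_image_le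
  intro K hK
  rw [not_le, Finset.one_lt_card_iff_nontrivial] at hle
  obtain ⟨K', hK', hne⟩ := hle.exists_ne K
  rw [Finset.mem_filter] at hK
  have hK := hK.2
  obtain ⟨a, rfl⟩ := K.exists_rep
  obtain ⟨b, rfl⟩ := K'.exists_rep
  obtain ⟨q⟩ := hF a b
  obtain ⟨d, -, hd1, hd2⟩ := q.exists_boundary_dart
    {x | G.connectedComponentMk x = G.connectedComponentMk a} rfl hne
  obtain ⟨⟨v, w⟩, hvw⟩ := d
  simp only [Set.mem_ofPred_eq] at hd1 hd2 hvw
  change UncutComponent G _ (G.connectedComponentMk a) at hK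
  have hR : (F \ G).Adj v w := by
    refine ⟨hvw, fun hG => hd2 ?_⟩
    rw [← hd1, SimpleGraph.ConnectedComponent.eq]
    exact hG.symm.reachable
  refine Finset.mem_image.2 ⟨v, Finset.mem_filter.2 ⟨Finset.mem_univ v, ?_, ?_⟩, hd1⟩
  · rwa [hd1]
  · by_cases hw : UnpairedIsolated G p w
    · have h1 := hp.matched_of_adj w v hw.1 hw.2 hvw.symm
      exact ⟨p v, hp.sdiff_adj_mate (hK v hd1).2 h1⟩
    · exact ⟨w, hR, hw⟩

/-- Ordered adjacent pairs of `F \ G` are split by whether the second point is unpaired isolated. An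
unpaired isolated point has two neighbours, both paired, and is counted twice in each direction. The
other three kinds of vertices are disjoint, and each has a neighbour that is not unpaired isolated.
-/
theorem MateExtension.two_mul_card_sdiff_ge (hV : 3 ≤ Fintype.card V) (h : CutMatching G m χ)
    (hp : MateExtension G F (cutMate m χ) p)
    (hdeg : ∀ v a, p v = v → a ≠ v → ∃ w, w ≠ a ∧ F.Adj v w) :
    4 * (Finset.univ.filter fun v => UnpairedIsolated G p v).card +
      (Finset.univ.filter fun v => m v = v ∧ G.degree v = 1).card +
      (Finset.univ.filter fun v => G.IsolatedVertex v ∧ p v ≠ v).card +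
      (Finset.univ.filter fun v => UncutExit G F (cutMate m χ) p v).card ≤
      2 * (F \ G).edgeSet.ncard := by
  obtain ⟨R, hR⟩ : ∃ R, R = F \ G := ⟨_, rfl⟩
  rw [← hR]
  have hiso : ∀ v w, G.IsolatedVertex v → F.Adj v w → R.Adj v w :=
    fun v w hv hvw => by rw [hR]; exact ⟨hvw, hv w⟩
  have htwo : ∀ v, UnpairedIsolated G p v → ∃ w w', w ≠ w' ∧ F.Adj v w ∧ F.Adj v w' := by
    intro v hv
    obtain ⟨a, ha, -⟩ := exists_ne_ne hV v v
    obtain ⟨w, -, hw⟩ := hdeg v a hv.2 ha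
    obtain ⟨w', hne, hw'⟩ := hdeg v w hv.2 hw.ne.symm
    exact ⟨w, w', hne.symm, hw, hw'⟩
  have hmt : ∀ v, m v = v → cutMate m χ v = v := by
    intro v hv
    unfold cutMate
    split_ifs
    · exact hv
    · rfl
  have hone : ∀ v, m v = v → G.degree v = 1 →
      ∃ w, R.Adj v w ∧ ¬ UnpairedIsolated G p w := by
    intro v hv hd
    by_cases hpv : p v = v
    · obtain ⟨s, hs⟩ : ∃ s, G.Adj v s := by
        by_contra! hcon
        rw [(G.degree_eq_zero_iff_isolatedVertex v).2 hcon] at hd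
        omega
      obtain ⟨w, hne, hw⟩ := hdeg v s hpv hs.ne.symm
      refine ⟨w, ?_, fun hcon => ?_⟩
      · rw [hR]
        exact ⟨hw, fun hG => hne (SimpleGraph.eq_of_degree_eq_one hd hG hs)⟩
      · exact hp.matched_of_adj w v hcon.1 hcon.2 hw.symm hpv
    · rw [hR]
      exact ⟨p v, hp.sdiff_adj_mate (hmt v hv) hpv⟩
  -- The double weight of leaves is used here: the neighbour of `v` is matched to a leaf, that edge
  -- is cut, and so the component of `v` is not uncut.
  have hexit : ∀ v, m v = v → G.degree v = 1 → ¬ UncutExit G F (cutMate m χ) p v := by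
    intro v hv hd hcon
    obtain ⟨s, hs⟩ : ∃ s, G.Adj v s := by
      by_contra! hcon
      rw [(G.degree_eq_zero_iff_isolatedVertex v).2 hcon] at hd
      omega
    have h1 := h.matched_of_adj v s hv hs
    have h2 := h.leaf_of_adj v s hv hs hd
    have h3 : G.Adj (m s) (m (m s)) := by rw [h.involutive s]; exact (h.adj s h1).symm
    have h4 := SimpleGraph.leaf_matching_edge_cut h.involutive h.reachable h3
      fun w hw => SimpleGraph.eq_of_degree_eq_one h2 hw h3
    refine cutMate_ne_iff.2 h4 (hcon.1 (m s) ?_).2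
    rw [SimpleGraph.ConnectedComponent.eq]
    exact (hs.reachable.trans (h.adj s h1).reachable).symm
  have hf : ∀ v, 2 * (if UnpairedIsolated G p v then 1 else 0) +
      (if m v = v ∧ G.degree v = 1 then 1 else 0) +
      (if G.IsolatedVertex v ∧ p v ≠ v then 1 else 0) +
      (if UncutExit G F (cutMate m χ) p v then 1 else 0) ≤
      ∑ w, if R.Adj v w ∧ ¬ UnpairedIsolated G p w then 1 else 0 := by
    intro v
    let Q : V → V → Prop := fun v w => R.Adj v w ∧ ¬ UnpairedIsolated G p w
    by_cases hv : G.IsolatedVertex v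
    · have hd : ¬ (m v = v ∧ G.degree v = 1) := fun hcon => by
        have := (G.degree_eq_zero_iff_isolatedVertex v).2 hv
        omega
      have hc : ¬ UncutExit G F (cutMate m χ) p v := fun hcon => (hcon.1 v rfl).1 hv
      rw [if_neg hd, if_neg hc]
      by_cases hpv : p v = v
      · obtain ⟨w, w', hne, hw, hw'⟩ := htwo v ⟨hv, hpv⟩
        rw [if_pos ⟨hv, hpv⟩, if_neg fun hcon => hcon.2 hpv]
        exact two_le_sum_indicator (Q := Q v) hne
          ⟨hiso v w hv hw, fun hcon => hp.matched_of_adj v w hv hpv hw hcon.2⟩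
          ⟨hiso v w' hv hw', fun hcon => hp.matched_of_adj v w' hv hpv hw' hcon.2⟩
      · rw [if_neg fun hcon => hpv hcon.2, if_pos ⟨hv, hpv⟩]
        refine one_le_sum_indicator (Q := Q v) (w := p v) ⟨hiso v _ hv (hp.adj v hpv), fun hcon => hpv ?_⟩
        rw [← hcon.2, hp.involutive v]
    · have h1 : ¬ UnpairedIsolated G p v := fun hcon => hv hcon.1
      have h2 : ¬ (G.IsolatedVertex v ∧ p v ≠ v) := fun hcon => hv hcon.1
      rw [if_neg h1, if_neg h2]
      by_cases hd : m v = v ∧ G.degree v = 1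
      · rw [if_pos hd, if_neg (hexit v hd.1 hd.2)]
        obtain ⟨w, hw⟩ := hone v hd.1 hd.2
        exact one_le_sum_indicator (Q := Q v) hw
      · rw [if_neg hd]
        split_ifs with hc
        · obtain ⟨w, hw⟩ := hc.2
          rw [← hR] at hw
          exact one_le_sum_indicator (Q := Q v) hw
        · exact Nat.zero_le _
  have hg : ∀ w, 2 * (if UnpairedIsolated G p w then 1 else 0) ≤
      ∑ v, if R.Adj v w ∧ UnpairedIsolated G p w then 1 else 0 := by
    intro w
    split_ifs with hw
    · obtain ⟨a, b, hne, ha, hb⟩ := htwo w hw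
      exact two_le_sum_indicator (Q := fun v => R.Adj v w ∧ UnpairedIsolated G p w) hne
        ⟨(hiso w a hw.1 ha).symm, hw⟩ ⟨(hiso w b hw.1 hb).symm, hw⟩
    · exact Nat.zero_le _
  have hsplit : ∑ v, ∑ w, (if R.Adj v w then 1 else 0) =
      ∑ v, ∑ w, (if R.Adj v w ∧ ¬ UnpairedIsolated G p w then 1 else 0) +
      ∑ w, ∑ v, (if R.Adj v w ∧ UnpairedIsolated G p w then 1 else 0) := by
    rw [Finset.sum_comm (f := fun w v => if R.Adj v w ∧ UnpairedIsolated G p w then 1 else 0),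
      ← Finset.sum_add_distrib]
    refine Finset.sum_congr rfl fun v _ => ?_
    rw [← Finset.sum_add_distrib]
    refine Finset.sum_congr rfl fun w _ => ?_
    by_cases h1 : R.Adj v w <;> by_cases h2 : UnpairedIsolated G p w <;> simp [h1, h2]
  have hf' := Finset.sum_le_sum fun v (_ : v ∈ Finset.univ) => hf v
  have hg' := Finset.sum_le_sum fun v (_ : v ∈ Finset.univ) => hg v
  rw [← R.sum_sum_adj_eq, hsplit]
  simp only [Finset.sum_add_distrib, ← Finset.mul_sum, ← Finset.card_filter] at hf' hg'
  simp only [← Finset.card_filter]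
  omega

end Counting

/-! ### Combining the counts. -/

section Bound

open scoped Classical

variable {V : Type*} [Fintype V] {G F : SimpleGraph V} {m p : V → V} {χ : V → Bool}

theorem SimpleGraph.Preconnected.two_mul_card_le_of_deleteMatching (hm : Function.Involutive p)
    (hadj : ∀ v, p v ≠ v → F.Adj v (p v)) (hV : 0 < Fintype.card V)
    (hconn : (F.deleteEdges (PairedColouring.matchingEdges p)).Preconnected) :
    2 * Fintype.card V + (Finset.univ.filter fun v => p v ≠ v).card ≤
      2 * F.edgeSet.ncard + 2 := by
  have hne : Nonempty V := Fintype.card_pos_iff.1 hV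
  have h1 := (SimpleGraph.Connected.mk hconn).card_vert_le_card_edgeSet_add_one
  have hsub : PairedColouring.matchingEdges p ⊆ F.edgeSet := by
    rintro e ⟨v, hv, rfl⟩
    exact hadj v hv
  have h2 : (F.deleteEdges (PairedColouring.matchingEdges p)).edgeSet.ncard +
      (PairedColouring.matchingEdges p).ncard = F.edgeSet.ncard := by
    rw [SimpleGraph.edgeSet_deleteEdges]
    exact Set.ncard_sdiff_add_ncard_of_subset hsub
  have h3 : 2 * (PairedColouring.matchingEdges p).ncard =
      (Finset.univ.filter fun v => p v ≠ v).card :=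
    hm.two_mul_ncard_pairs fun v hv => ⟨by rw [hm v]; exact hv.symm, hv⟩
  rw [Nat.card_coe_set_eq, Nat.card_eq_fintype_card] at h1
  omega

theorem card_filter_eq_add (P Q : V → Prop) [DecidablePred P] [DecidablePred Q] :
    (Finset.univ.filter P).card = (Finset.univ.filter fun v => P v ∧ Q v).card +
      (Finset.univ.filter fun v => P v ∧ ¬ Q v).card := by
  rw [← Finset.filter_filter, ← Finset.filter_filter, Finset.card_filter_add_card_filter_not]

theorem nine_mul_card_le (hV : 3 ≤ Fintype.card V) (hGF : G ≤ F) (h : CutMatching G m χ)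
    (hp : MateExtension G F (cutMate m χ) p)
    (hconn : (F.deleteEdges (PairedColouring.matchingEdges p)).Preconnected)
    (hdeg : ∀ v a, p v = v → a ≠ v → ∃ w, w ≠ a ∧ F.Adj v w) :
    9 * Fintype.card V ≤ 8 * F.edgeSet.ncard + 7 := by
  have hF : F.Preconnected := hconn.mono (SimpleGraph.deleteEdges_le _)
  have c1 := SimpleGraph.Preconnected.two_mul_card_le_of_deleteMatching hp.involutive hp.adj
    (by omega) hconn
  have c2 := SimpleGraph.card_connectedComponent_le_add_ncard hGF
  have c2' : Nat.card F.ConnectedComponent ≤ 1 := by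
    rw [Finite.card_le_one_iff_subsingleton]
    exact hF.subsingleton_connectedComponent
  have c3 := h.sum_degree_le
  have c4 := hp.two_mul_card_sdiff_ge hV h hdeg
  have c4' := hp.card_uncutComponent_le hF
  have c5 := SimpleGraph.card_add_uncut_le h.involutive h.adj h.reachable
  have c6 := h.two_mul_card_component_le
  have hE : (F \ G).edgeSet.ncard + G.edgeSet.ncard = F.edgeSet.ncard := by
    rw [SimpleGraph.edgeSet_sdiff]
    exact Set.ncard_sdiff_add_ncard_of_subset (SimpleGraph.edgeSet_subset_edgeSet.2 hGF)
  rw [← SimpleGraph.edgeSet_sdiff] at c2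
  have d1 : Fintype.card V = (Finset.univ.filter fun v => m v ≠ v).card +
      (Finset.univ.filter fun v => m v = v).card := by
    rw [add_comm, ← Finset.card_univ]
    exact (Finset.card_filter_add_card_filter_not _).symm
  have d2 : (Finset.univ.filter fun v => m v ≠ v).card =
      (Finset.univ.filter fun v => cutMate m χ v ≠ v).card +
      (Finset.univ.filter fun v => m v ≠ v ∧ χ v = χ (m v)).card := by
    rw [card_filter_eq_add (fun v => m v ≠ v) (fun v => χ v = χ (m v)), add_comm]
    congr 2
    ext v
    simp only [Finset.mem_filter, Finset.mem_univ, true_and, cutMate_ne_iff]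
    exact ⟨fun h => h.2, fun h => ⟨fun hv => h (by rw [hv]), h⟩⟩
  have d3 : (Finset.univ.filter fun v => G.IsolatedVertex v).card =
      (Finset.univ.filter fun v => UnpairedIsolated G p v).card +
      (Finset.univ.filter fun v => G.IsolatedVertex v ∧ p v ≠ v).card := by
    rw [card_filter_eq_add G.IsolatedVertex (fun v => p v = v)]
    congr 1
    refine congrArg Finset.card (Finset.ext fun v => ?_)
    rw [Finset.mem_filter, Finset.mem_filter, UnpairedIsolated]
  have d4 : (Finset.univ.filter fun v => G.IsolatedVertex v ∧ p v ≠ v).card +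
      (Finset.univ.filter fun v => cutMate m χ v ≠ v).card ≤
      (Finset.univ.filter fun v => p v ≠ v).card := by
    rw [← Finset.card_union_of_disjoint]
    · refine Finset.card_le_card fun v hv => ?_
      simp only [Finset.mem_union, Finset.mem_filter, Finset.mem_univ, true_and] at hv ⊢
      rcases hv with hv | hv
      · exact hv.2
      · rw [hp.eq_of_ne v hv]; exact hv
    · rw [Finset.disjoint_filter]
      exact fun v _ hv hv' => h.not_isolated hv' hv.1
  have d5 : (Finset.univ.filter fun v => m v = v).card ≤
      (Finset.univ.filter fun v => G.IsolatedVertex v).card +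
      (Finset.univ.filter fun v => m v = v ∧ G.degree v = 1).card +
      (Finset.univ.filter fun v => m v = v ∧ 2 ≤ G.degree v).card := by
    simp only [Finset.card_filter, ← Finset.sum_add_distrib]
    refine Finset.sum_le_sum fun v _ => ?_
    have := G.degree_eq_zero_iff_isolatedVertex v
    by_cases hv : m v = v
    · simp only [hv, true_and, if_true, ← this]
      split_ifs <;> omega
    · simp [hv]
  have d6 : (Finset.univ.filter fun v => m v = v ∧ G.degree v = 1).card +
      2 * (Finset.univ.filter fun v => m v = v ∧ 2 ≤ G.degree v).card ≤
      ∑ v, (if m v = v then G.degree v else 0) := by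
    simp only [Finset.card_filter, Finset.mul_sum, ← Finset.sum_add_distrib]
    refine Finset.sum_le_sum fun v _ => ?_
    by_cases hv : m v = v
    · simp only [hv, true_and, if_true]
      split_ifs <;> omega
    · simp [hv]
  -- The combination is `4 c1 + 4 c2 + c3 + 2 c4 + 2 c4' + 3 c5 + c6`, which gives `18 |V| ≤ 16 |F|
  -- + 14`.
  omega

/-- The placement is chosen from `G` alone, before `F`; only the extension `p` depends on `F`. -/
theorem exists_placement_nine_mul_card_le (hV : 3 ≤ Fintype.card V) (G : SimpleGraph V) :
    ∃ x : V → ℝ, Function.Injective x ∧ ∀ F : SimpleGraph V, G ≤ F → RigidOver G F x →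
      9 * Fintype.card V ≤ 8 * F.edgeSet.ncard + 7 := by
  obtain ⟨m, χ, h⟩ := exists_cutMatching G
  let r : V → ℕ := fun v => Fintype.equivFin V v
  have hr : Function.Injective r := Fin.val_injective.comp (Fintype.equivFin V).injective
  refine ⟨_, (h.pairedColouring hr).basePlacement_injective, fun F hGF hrig => ?_⟩
  obtain ⟨p, hp⟩ := h.exists_mateExtension hGF
  have hc := hp.pairedColouring h hr
  have hrig' := hp.rigidOver h hrig
  exact nine_mul_card_le hV hGF h hp (hc.deleteMatching_preconnected hV hGF hrig')
    fun v a hv ha => hc.exists_adj_ne hV hrig' hv ha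

end Bound

/-! ### Back to two-round algorithms. -/

theorem TwoRoundAlgorithm.ProducesLineRigid.rigidOver {n : ℕ} {A : TwoRoundAlgorithm n}
    (hA : A.ProducesLineRigid) (x : Fin n → ℝ) : RigidOver A.firstRound (A.ppg x).graph x := by
  intro y hy hyx z hz hzy
  have hans : A.firstAnswers y = A.firstAnswers x := by
    funext ⟨e, he⟩
    induction e with | _ u v =>
    exact hyx u v he
  have hgraph : (A.ppg y).graph = (A.ppg x).graph := by
    simp only [TwoRoundAlgorithm.ppg, hans]
  refine (hA y hy).2 y z ⟨hy, fun _ => rfl⟩ ⟨hz, ?_⟩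
  rintro ⟨e, he⟩
  induction e with | _ u v =>
  rw [hgraph] at he
  exact hzy u v he

theorem theorem4 (ε : ℝ) (hε : 0 < ε) :
    ∃ N : ℕ, ∀ n : ℕ, N ≤ n → ∀ A : TwoRoundAlgorithm n, A.ProducesLineRigid →
      ∃ x : Fin n → ℝ, Function.Injective x ∧
        (9 / 8 - ε) * (n : ℝ) ≤ (A.numQueries x : ℝ) := by
  obtain ⟨N, hN⟩ := exists_nat_ge (1 / ε)
  -- `N ≥ 1/ε` makes `ε n ≥ 1` absorb the constant `7/8`; the `3` guarantees three points.
  refine ⟨N + 3, fun n hn A hA => ?_⟩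
  obtain ⟨x, hx, hbound⟩ := exists_placement_nine_mul_card_le
    (V := Fin n) (by rw [Fintype.card_fin]; omega) A.firstRound
  refine ⟨x, hx, ?_⟩
  have h1 := hbound (A.ppg x).graph le_sup_left (hA.rigidOver x)
  rw [Fintype.card_fin] at h1
  have h2 : (9 * n : ℝ) ≤ 8 * (A.numQueries x : ℝ) + 7 := by exact_mod_cast h1
  have h3 : (N : ℝ) ≤ n := by exact_mod_cast (by omega : N ≤ n)
  have h4 : 1 ≤ ε * n := by
    rw [div_le_iff₀ hε] at hN
    nlinarith
  linarith
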